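/- Let $G$ be a finite simple graph (not necessarily connected) with at least one perfect matching, viewed as an edge set. For a perfect matching $M$ of $G$ let $q^M\in\mathbb{R}^{E(G)}$ be its incidence vector, and let $PM(G)$, the perfect matching polytope of $G$, be the convex hull of $\{q^M : M \text{ a perfect matching of } G\}$. A vector $x\in\mathbb{R}^{E(G)}$ is 1-regular if for every vertex $v$ the sum of $x(e)$ over the edges $e$ incident with $v$ equals $1$. Let $\mathcal{G}$ be the class of graphs that have a perfect matching and contain no two vertex-disjoint odd cycles $C$, $C'$ such that $G-V(C)-V(C')$ has a perfect matching (the graph with no vertices has the empty perfect matching). A global forcing set of $G$ is a set $S\subseteq E(G)$ such that $M_1\cap S\neq M_2\cap S$ for any two distinct perfect matchings $M_1,M_2$ of $G$; $gf(G)$ is the minimum size of a global forcing set. An anti-forcing set of a perfect matching $M$ is a set $S\subseteq E(G)\setminus M$ such that $G-S$ has a unique perfect matching; $af(G,M)$ is the minimum size of an anti-forcing set of $M$, and $Af(G)$ is the maximum of $af(G,M)$ over all perfect matchings $M$ of $G$. If $PM(G)$ is equal to the set of all non-negative 1-regular vectors in $\mathbb{R}^{E(G)}$, then $G\in\mathcal{G}$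 and $gf(G)\geq Af(G)$. -/

import Mathlib

namespace PMPolytope

variable {V : Type*}

/-- `S` is a global forcing set of `G`: an edge subset on which no two distinct perfect
matchings of `G` coincide. -/
def IsGlobalForcingSet (G : SimpleGraph V) (S : Set (Sym2 V)) : Prop :=
  S ⊆ G.edgeSet ∧ ∀ M₁ M₂ : G.Subgraph, M₁.IsPerfectMatching → M₂.IsPerfectMatching →
    M₁.edgeSet ∩ S = M₂.edgeSet ∩ S → M₁ = M₂

/-- The global forcing number `gf(G)`: the minimum size of a global forcing set. -/
noncomputable def gf (G : SimpleGraph V) : ℕ :=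
  sInf {k | ∃ S, IsGlobalForcingSet G S ∧ S.ncard = k}

/-- `S` is an anti-forcing set of the perfect matching `M` of `G`: `S ⊆ E(G) \ M`, and `G - S`
has a unique perfect matching. -/
def IsAntiForcingSet (G : SimpleGraph V) (M : G.Subgraph) (S : Set (Sym2 V)) : Prop :=
  S ⊆ G.edgeSet \ M.edgeSet ∧ ∃! M' : (G.deleteEdges S).Subgraph, M'.IsPerfectMatching

/-- The anti-forcing number `af(G, M)`: the minimum size of an anti-forcing set of `M`. -/
noncomputable def af (G : SimpleGraph V) (M : G.Subgraph) : ℕ :=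
  sInf {k | ∃ S, IsAntiForcingSet G M S ∧ S.ncard = k}

/-- The maximum anti-forcing number `Af(G)`, over all perfect matchings of `G`. -/
noncomputable def Af (G : SimpleGraph V) : ℕ :=
  sSup {k | ∃ M : G.Subgraph, M.IsPerfectMatching ∧ af G M = k}

/-- The incidence vector of (the edge set of) `M` in `ℝ^{E(G)}`. -/
noncomputable def incidenceVector (G : SimpleGraph V) (M : G.Subgraph) : G.edgeSet → ℝ :=
  Set.indicator {e | (e : Sym2 V) ∈ M.edgeSet} 1

/-- The perfect matching polytope `PM(G)`: the convex hull of the incidence vectors of the perfect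
matchings of `G`. -/
def perfectMatchingPolytope (G : SimpleGraph V) : Set (G.edgeSet → ℝ) :=
  convexHull ℝ {q | ∃ M : G.Subgraph, M.IsPerfectMatching ∧ q = incidenceVector G M}

open Classical in
/-- `x ∈ ℝ^{E(G)}` is 1-regular: the entries on the edges at each vertex sum to `1`. -/
def IsOneRegular [Fintype V] (G : SimpleGraph V) (x : G.edgeSet → ℝ) : Prop :=
  ∀ v : V, ∑ e ∈ Finset.univ.filter (fun e : G.edgeSet => v ∈ (e : Sym2 V)), x e = 1

/-- The class `𝒢`: graphs with a perfect matching that contain no two (vertex-)disjoint odd cycles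
`C` and `C'` such that `G - C - C'` has a perfect matching. -/
def InClassG (G : SimpleGraph V) : Prop :=
  (∃ M : G.Subgraph, M.IsPerfectMatching) ∧
  ¬ ∃ (u w : V) (C : G.Walk u u) (C' : G.Walk w w),
    C.IsCycle ∧ Odd C.length ∧ C'.IsCycle ∧ Odd C'.length ∧
    (∀ v, v ∈ C.support → v ∉ C'.support) ∧
    ∃ M : (G.induce {v | v ∉ C.support ∧ v ∉ C'.support}).Subgraph, M.IsPerfectMatching

end PMPolytope

namespace PMPolytope

variable {V : Type*}

/-! Everything rests on `exists_isMate_of_injective`. If a permutation σ moves every vertex along an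
edge, giving weight 1/2 to each edge vσ(v) makes a non-negative 1-regular vector. By hypothesis it
is a convex combination of perfect matchings, so the edges vσ(v) contain a perfect matching through
any prescribed one of them. If two disjoint odd cycles had a perfectly matched complement, rotating
the cycles and swapping along the matching would be such a σ. A perfect matching inside its edges
would pair up the vertices of an odd cycle. For the inequality, `IsGlobalForcingSet.exists_vertex`
yields, in any vertex set closed under a matching, a vertex with at most one inner edge outside the
global forcing set S. Peeling off such vertices with their partners builds an anti-forcing set of
size at most |S|. -/

/-! ### Perfect matchings as fixed-point-free involutions -/

/-- `n` sends every vertex to its partner in a perfect matching of `H`. -/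
def IsMate (H : SimpleGraph V) (n : V → V) : Prop :=
  ∀ v, H.Adj v (n v) ∧ n (n v) = v

/-- The perfect matching with partner function `n`. -/
def IsMate.toSubgraph {H : SimpleGraph V} {n : V → V} (h : IsMate H n) : H.Subgraph where
  verts := Set.univ
  Adj v w := n v = w
  adj_sub := by rintro v _ rfl; exact (h v).1
  edge_vert := fun _ => Set.mem_univ _
  symm := ⟨by rintro v _ rfl; exact (h v).2⟩

theorem IsMate.isPerfectMatching {H : SimpleGraph V} {n : V → V} (h : IsMate H n) :
    h.toSubgraph.IsPerfectMatching :=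
  ⟨fun v _ => ⟨n v, rfl, fun _ hw => Eq.symm hw⟩, fun v => Set.mem_univ v⟩

theorem exists_isMate {H : SimpleGraph V} {M : H.Subgraph} (hM : M.IsPerfectMatching) :
    ∃ n, IsMate H n ∧ ∀ v w, M.Adj v w ↔ n v = w := by
  have h : ∀ v, ∃! w, M.Adj v w := fun v => hM.1 (hM.2 v)
  choose n hn hu using h
  have key : ∀ v w, M.Adj v w ↔ n v = w := fun v w =>
    ⟨fun h => (hu v w h).symm, fun h => h ▸ hn v⟩
  exact ⟨n, fun v => ⟨(hn v).adj_sub, (key _ _).1 (hn v).symm⟩, key⟩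

theorem eq_of_adj_iff {H : SimpleGraph V} {M₁ M₂ : H.Subgraph} (h₁ : M₁.IsPerfectMatching)
    (h₂ : M₂.IsPerfectMatching) {n : V → V} (k₁ : ∀ v w, M₁.Adj v w ↔ n v = w)
    (k₂ : ∀ v w, M₂.Adj v w ↔ n v = w) : M₁ = M₂ := by
  refine SimpleGraph.Subgraph.ext ?_ ?_
  · rw [h₁.2.verts_eq_univ, h₂.2.verts_eq_univ]
  · funext v w
    exact propext ((k₁ v w).trans (k₂ v w).symm)

theorem IsGlobalForcingSet.eq_of_isMate {G : SimpleGraph V} {S : Set (Sym2 V)}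
    (hS : IsGlobalForcingSet G S) {n₁ n₂ : V → V} (h₁ : IsMate G n₁) (h₂ : IsMate G n₂)
    (h : ∀ v, s(v, n₁ v) ∈ S ∨ s(v, n₂ v) ∈ S → n₁ v = n₂ v) : n₁ = n₂ := by
  have key : h₁.toSubgraph = h₂.toSubgraph := by
    refine hS.2 _ _ h₁.isPerfectMatching h₂.isPerfectMatching (Set.ext fun e => ?_)
    induction e using Sym2.ind with
    | _ v w =>
      change n₁ v = w ∧ s(v, w) ∈ S ↔ n₂ v = w ∧ s(v, w) ∈ S
      constructor
      · rintro ⟨rfl, hs⟩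
        exact ⟨(h v (Or.inl hs)).symm, hs⟩
      · rintro ⟨rfl, hs⟩
        exact ⟨h v (Or.inr hs), hs⟩
  funext v
  have : h₁.toSubgraph.Adj v (n₁ v) := rfl
  rw [key] at this
  exact Eq.symm this

/-! ### Matchings in the support of a polytope point -/

/-- Incidence vectors are non-negative, so nothing cancels: a matching of positive weight in the
convex combination lies in the support of `x`, and some such matching uses the given edge. -/
theorem exists_isMate_of_mem_polytope {G : SimpleGraph V} {x : G.edgeSet → ℝ}
    (hx : x ∈ perfectMatchingPolytope G) {v₀ w₀ : V} (h₀ : G.Adj v₀ w₀)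
    (hpos : 0 < x ⟨s(v₀, w₀), h₀⟩) :
    ∃ n, IsMate G n ∧ n v₀ = w₀ ∧ ∀ v (h : G.Adj v (n v)), 0 < x ⟨s(v, n v), h⟩ := by
  obtain ⟨ι, _, c, z, hc, -, hz, rfl⟩ := mem_convexHull_iff_exists_fintype.1 hx
  simp only [Finset.sum_apply, Pi.smul_apply, smul_eq_mul] at hpos ⊢
  obtain ⟨i, -, hi⟩ := Finset.exists_lt_of_sum_lt
    (s := Finset.univ) (f := fun _ : ι => (0 : ℝ)) (by simpa using hpos)
  choose M hM hzM using hz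
  obtain ⟨n, hn, hnM⟩ := exists_isMate (hM i)
  have hnonneg : ∀ j e, 0 ≤ z j e := fun j e => by
    rw [hzM]; exact Set.indicator_nonneg (fun _ _ => zero_le_one) e
  refine ⟨n, hn, ?_, fun v hv => ?_⟩
  · by_contra hne
    rw [hzM, incidenceVector, Set.indicator_of_notMem, mul_zero] at hi
    · exact lt_irrefl _ hi
    · simpa [hnM] using hne
  · refine Finset.sum_pos' (fun j _ => mul_nonneg (hc j) (hnonneg j _)) ⟨i, Finset.mem_univ i, ?_⟩
    have hci : 0 < c i := (hc i).lt_of_ne fun h => by simp [← h] at hi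
    have hone : z i ⟨s(v, n v), hv⟩ = 1 := by
      rw [hzM, incidenceVector, Set.indicator_of_mem]
      · rfl
      · simp [hnM]
    rw [hone, mul_one]
    exact hci

/-- A permutation along edges gives a `1`-regular vector, hence perfect matchings inside it. -/
theorem exists_isMate_of_injective [Fintype V] {G : SimpleGraph V}
    (hPM : perfectMatchingPolytope G =
      {x : G.edgeSet → ℝ | (∀ e, 0 ≤ x e) ∧ IsOneRegular G x})
    {σ : V → V} (hσ : σ.Injective) (hadj : ∀ v, G.Adj v (σ v)) (v₀ : V) :
    ∃ n, IsMate G n ∧ n v₀ = σ v₀ ∧ ∀ v, n v = σ v ∨ σ (n v) = v := by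
  classical
  -- Each vertex `v` receives 1/2 from its outgoing and 1/2 from its incoming σ-edge; an edge
  -- swapped by σ gets total weight 1.
  set x : G.edgeSet → ℝ := fun e =>
    ∑ v : V, if (e : Sym2 V) = s(v, σ v) then (1 / 2 : ℝ) else 0 with hx
  have hterm : ∀ (e : G.edgeSet) (v : V),
      0 ≤ if (e : Sym2 V) = s(v, σ v) then (1 / 2 : ℝ) else 0 := fun e v => by
    split_ifs <;> norm_num
  have hreg : IsOneRegular G x := by
    intro v
    have hsplit : ∀ u : V,
        (∑ e ∈ Finset.univ.filter (fun e : G.edgeSet => v ∈ (e : Sym2 V)),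
          if (e : Sym2 V) = s(u, σ u) then (1 / 2 : ℝ) else 0) =
        (if u = v then 1 / 2 else 0) + (if σ u = v then 1 / 2 else 0) := by
      intro u
      have hne := (hadj u).ne
      rw [Finset.sum_filter, Finset.sum_eq_single (⟨s(u, σ u), hadj u⟩ : G.edgeSet)]
      · by_cases h1 : u = v
        · subst h1
          simp [hne.symm]
        · by_cases h2 : σ u = v
          · simp [h1, h2]
          · simp [h1, h2, Ne.symm h1, Ne.symm h2]
      · intro e _ he
        rw [if_neg (show ¬ (e : Sym2 V) = s(u, σ u) from fun h => he (Subtype.ext h)), ite_self]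
      · exact fun h => absurd (Finset.mem_univ _) h
    obtain ⟨w, rfl⟩ := (Finite.surjective_of_injective hσ) v
    have hsum : ∑ e ∈ Finset.univ.filter (fun e : G.edgeSet => σ w ∈ (e : Sym2 V)), x e = 1 := by
      rw [hx, Finset.sum_comm, Finset.sum_congr rfl fun u _ => hsplit u, Finset.sum_add_distrib]
      simp only [hσ.eq_iff, Finset.sum_ite_eq', Finset.mem_univ, if_true]
      norm_num
    convert hsum
  have hmem : x ∈ perfectMatchingPolytope G := by
    rw [hPM]
    exact ⟨fun e => Finset.sum_nonneg fun v _ => hterm e v, hreg⟩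
  obtain ⟨n, hn, hn₀, hpos⟩ := exists_isMate_of_mem_polytope hmem (hadj v₀)
    (Finset.sum_pos' (fun v _ => hterm _ v) ⟨v₀, Finset.mem_univ _, by norm_num⟩)
  refine ⟨n, hn, hn₀, fun v => ?_⟩
  obtain ⟨w, -, hw⟩ := Finset.exists_lt_of_sum_lt
    (s := Finset.univ) (f := fun _ : V => (0 : ℝ)) (by simpa using hpos v (hn v).1)
  have hw' : s(v, n v) = s(w, σ w) := by
    by_contra h
    simp [h] at hw
  rcases Sym2.eq_iff.1 hw' with ⟨rfl, h⟩ | ⟨h, rfl⟩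
  · exact Or.inl h
  · exact Or.inr h.symm

/-! ### Odd cycles and membership in the class 𝒢 -/

theorem even_card_of_involution {O : Finset V} {n : V → V} (hn : ∀ v, n (n v) = v)
    (hne : ∀ v, n v ≠ v) (hO : ∀ v ∈ O, n v ∈ O) : Even O.card := by
  have h : ∑ _v ∈ O, (1 : ZMod 2) = 0 :=
    Finset.sum_involution (fun v _ => n v) (fun _ _ => by decide) (fun v _ _ => hne v)
      (fun v hv => hO v hv) (fun v _ => hn v)
  rw [Finset.sum_const, nsmul_eq_mul, mul_one] at h
  exact (ZMod.natCast_eq_zero_iff_even).1 h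

/-- The permutation of the vertices that rotates a cycle by one step. -/
theorem exists_perm_of_isCycle {G : SimpleGraph V} {u : V} {C : G.Walk u u}
    (hC : C.IsCycle) :
    ∃ f : Equiv.Perm V, ∀ v ∈ C.support, f v ∈ C.support ∧ G.Adj v (f v) := by
  classical
  have hlen : C.support.tail.length = C.length := by simp
  have h3 := hC.three_le_length
  have hmem : ∀ v, v ∈ C.support ↔ v ∈ C.support.tail := fun v => by
    rw [C.mem_support_iff]
    constructor
    · rintro (rfl | h)
      · exact C.end_mem_tail_support hC.not_nil
      · exact h
    · exact Or.inr
  have hget : ∀ i (hi : i < C.support.tail.length), C.support.tail[i] = C.getVert (i + 1) := by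
    intro i hi
    rw [C.getVert_eq_support_getElem (by omega), List.getElem_tail]
  refine ⟨C.support.tail.formPerm, fun v hv => ⟨?_, ?_⟩⟩
  · rw [hmem] at hv ⊢
    exact List.formPerm_apply_mem_of_mem hv
  · obtain ⟨i, hi, rfl⟩ := List.getElem_of_mem ((hmem v).1 hv)
    rw [List.formPerm_apply_getElem _ hC.support_nodup, hget, hget]
    rw [hlen] at hi
    rcases Nat.lt_or_ge (i + 1) C.length with h | h
    · rw [hlen, Nat.mod_eq_of_lt h]
      exact C.adj_getVert_succ h
    · obtain h : i + 1 = C.length := by omega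
      rw [hlen, h, Nat.mod_self, C.getVert_length]
      simpa using C.adj_getVert_succ (i := 0) (by omega)

theorem card_support_of_isCycle [DecidableEq V] {G : SimpleGraph V} {u : V} {C : G.Walk u u}
    (hC : C.IsCycle) : C.support.toFinset.card = C.length := by
  have h : C.support.toFinset = C.support.tail.toFinset := by
    ext v
    rw [List.mem_toFinset, List.mem_toFinset, C.mem_support_iff]
    constructor
    · rintro (rfl | h)
      · exact C.end_mem_tail_support hC.not_nil
      · exact h
    · exact Or.inr
  rw [h, List.toFinset_card_of_nodup hC.support_nodup]
  simp

theorem inClassG_of_polytope_eq [Fintype V] {G : SimpleGraph V}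
    (hG : ∃ M : G.Subgraph, M.IsPerfectMatching)
    (hPM : perfectMatchingPolytope G =
      {x : G.edgeSet → ℝ | (∀ e, 0 ≤ x e) ∧ IsOneRegular G x}) : InClassG G := by
  classical
  refine ⟨hG, ?_⟩
  rintro ⟨u, w, C, C', hC, hodd, hC', -, hdisj, M, hM⟩
  obtain ⟨f, hf⟩ := exists_perm_of_isCycle hC
  obtain ⟨f', hf'⟩ := exists_perm_of_isCycle hC'
  obtain ⟨m, hm, -⟩ := exists_isMate hM
  set σ : V → V := fun v =>
    if h : v ∈ C.support then f v else if h' : v ∈ C'.support then f' v else m ⟨v, h, h'⟩ with hσ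
  have h₁ : ∀ v, v ∈ C.support → σ v = f v := fun v h => by simp [hσ, h]
  have h₂ : ∀ v, v ∈ C'.support → σ v = f' v := fun v h => by
    have : v ∉ C.support := fun h' => hdisj v h' h
    simp [hσ, h, this]
  have h₃ : ∀ v (h : v ∉ C.support ∧ v ∉ C'.support), σ v = m ⟨v, h⟩ := fun v h => by
    simp [hσ, h.1, h.2]
  have hcase : ∀ v, v ∈ C.support ∨ v ∈ C'.support ∨ (v ∉ C.support ∧ v ∉ C'.support) :=
    fun v => by tauto
  have hadj : ∀ v, G.Adj v (σ v) := by
    intro v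
    rcases hcase v with h | h | h
    · rw [h₁ v h]; exact (hf v h).2
    · rw [h₂ v h]; exact (hf' v h).2
    · rw [h₃ v h]; exact (hm ⟨v, h⟩).1
  have k₁ : ∀ v, v ∈ C.support ↔ σ v ∈ C.support := by
    intro v
    rcases hcase v with h | h | h
    · rw [h₁ v h]; exact iff_of_true h (hf v h).1
    · rw [h₂ v h]
      exact iff_of_false (fun h' => hdisj v h' h) (fun h' => hdisj _ h' (hf' v h).1)
    · rw [h₃ v h]; exact iff_of_false h.1 (m ⟨v, h⟩).2.1
  have k₂ : ∀ v, v ∈ C'.support ↔ σ v ∈ C'.support := by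
    intro v
    rcases hcase v with h | h | h
    · rw [h₁ v h]
      exact iff_of_false (fun h' => hdisj v h h') (fun h' => hdisj _ (hf v h).1 h')
    · rw [h₂ v h]; exact iff_of_true h (hf' v h).1
    · rw [h₃ v h]; exact iff_of_false h.2 (m ⟨v, h⟩).2.2
  have hinj : σ.Injective := by
    intro a b hab
    have e₁ : a ∈ C.support ↔ b ∈ C.support := by rw [k₁ a, k₁ b, hab]
    have e₂ : a ∈ C'.support ↔ b ∈ C'.support := by rw [k₂ a, k₂ b, hab]
    rcases hcase a with h | h | h
    · rw [h₁ a h, h₁ b (e₁.1 h)] at hab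
      exact f.injective hab
    · rw [h₂ a h, h₂ b (e₂.1 h)] at hab
      exact f'.injective hab
    · have hb : b ∉ C.support ∧ b ∉ C'.support := ⟨mt e₁.2 h.1, mt e₂.2 h.2⟩
      rw [h₃ a h, h₃ b hb] at hab
      have := congrArg m (Subtype.ext hab)
      rw [(hm _).2, (hm _).2] at this
      exact congrArg Subtype.val this
  obtain ⟨n, hn, -, hnσ⟩ := exists_isMate_of_injective hPM hinj hadj u
  -- Both σ and its inverse preserve the cycle, hence so does `n`.
  have heven : Even C.support.toFinset.card := by
    refine even_card_of_involution (fun v => (hn v).2) (fun v => (hn v).1.ne') fun v hv => ?_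
    rw [List.mem_toFinset] at hv ⊢
    rcases hnσ v with h | h
    · rw [h, ← k₁]; exact hv
    · rw [k₁, h]; exact hv
  rw [card_support_of_isCycle hC] at heven
  exact Nat.not_even_iff_odd.2 hodd heven

/-! ### Global forcing sets bound anti-forcing numbers -/

/-- In every `m`-closed vertex set some vertex has at most one edge outside a global forcing set. -/
theorem IsGlobalForcingSet.exists_vertex [Fintype V] {G : SimpleGraph V}
    (hPM : perfectMatchingPolytope G =
      {x : G.edgeSet → ℝ | (∀ e, 0 ≤ x e) ∧ IsOneRegular G x})
    {S : Set (Sym2 V)} (hS : IsGlobalForcingSet G S) {m : V → V} (hm : IsMate G m)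
    {W : Finset V} (hW : W.Nonempty) (hmW : ∀ v ∈ W, m v ∈ W) :
    ∃ u ∈ W, ∀ w ∈ W, ∀ w' ∈ W, G.Adj u w → s(u, w) ∉ S → G.Adj u w' → s(u, w') ∉ S →
      w = w' := by
  classical
  by_contra! hcon
  -- Extremal choice: among matchings agreeing with `m` off `W`, `n` covers the fewest vertices by
  -- edges of `S`.
  obtain ⟨n, hn, hmin⟩ := Finset.exists_min_image
    (Finset.univ.filter fun n : V → V => IsMate G n ∧ ∀ v ∉ W, n v = m v)
    (fun n => (Finset.univ.filter fun v => s(v, n v) ∈ S).card) ⟨m, by simp [hm]⟩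
  simp only [Finset.mem_filter, Finset.mem_univ, true_and] at hn hmin
  obtain ⟨hn, hnm⟩ := hn
  have hmW' : ∀ v ∉ W, m v ∉ W := fun v hv h => hv ((hm v).2 ▸ hmW _ h)
  have hnW : ∀ v ∈ W, n v ∈ W := by
    intro v hv
    by_contra h
    have := hnm _ h
    rw [(hn v).2] at this
    exact hmW' _ h (this ▸ hv)
  have hg : ∀ v, ∃ w, v ∈ W → w ∈ W ∧ G.Adj v w ∧ s(v, w) ∉ S ∧ w ≠ n v := by
    intro v
    by_cases hv : v ∈ W
    · obtain ⟨w, hw, w', hw', ha, hs, ha', hs', hne⟩ := hcon v hv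
      by_cases h : w = n v
      · exact ⟨w', fun _ => ⟨hw', ha', hs', fun h' => hne (h.trans h'.symm)⟩⟩
      · exact ⟨w, fun _ => ⟨hw, ha, hs, h⟩⟩
    · exact ⟨v, fun h => absurd h hv⟩
  choose g hg using hg
  -- On a smallest non-empty invariant set the map a ↦ g(n a) is onto, hence injective: this gives
  -- an alternating closed structure to switch along.
  obtain ⟨P, hP, hPmin⟩ := Finset.exists_min_image
    (W.powerset.filter fun P => P.Nonempty ∧ ∀ a ∈ P, g (n a) ∈ P) Finset.card
    ⟨W, by simpa [hW] using fun a ha => (hg _ (hnW a ha)).1⟩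
  simp only [Finset.mem_filter, Finset.mem_powerset] at hP hPmin
  obtain ⟨hPW, hPne, hPh⟩ := hP
  have hsub : P.image (fun a => g (n a)) ⊆ P := Finset.image_subset_iff.2 hPh
  have hcard : (P.image fun a => g (n a)).card = P.card :=
    le_antisymm (Finset.card_le_card hsub) <| hPmin _ ⟨hsub.trans hPW, hPne.image _, fun a ha =>
      Finset.mem_image_of_mem _ (hsub ha)⟩
  have hinjP := Finset.card_image_iff.1 hcard
  set σ : V → V := fun v => if n v ∈ P then g v else n v with hσ
  have hσ₁ : ∀ v, n v ∈ P → σ v = g v := fun v h => if_pos h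
  have hσ₂ : ∀ v, n v ∉ P → σ v = n v := fun v h => if_neg h
  have hvW : ∀ v, n v ∈ P → v ∈ W := fun v h => (hn v).2 ▸ hnW _ (hPW h)
  have hgP : ∀ v, n v ∈ P → g v ∈ P := fun v h => by simpa [(hn v).2] using hPh _ h
  have hadj : ∀ v, G.Adj v (σ v) := by
    intro v
    by_cases h : n v ∈ P
    · rw [hσ₁ v h]; exact (hg v (hvW v h)).2.1
    · rw [hσ₂ v h]; exact (hn v).1
  have hσinj : σ.Injective := by
    intro a b hab
    suffices h : n a = n b by rw [← (hn a).2, h, (hn b).2]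
    by_cases ha : n a ∈ P <;> by_cases hb : n b ∈ P
    · rw [hσ₁ a ha, hσ₁ b hb] at hab
      refine hinjP ha hb ?_
      simpa [(hn a).2, (hn b).2] using hab
    · rw [hσ₁ a ha, hσ₂ b hb] at hab
      exact absurd (hab ▸ hgP a ha) hb
    · rw [hσ₂ a ha, hσ₁ b hb] at hab
      exact absurd (hab ▸ hgP b hb) ha
    · rwa [hσ₂ a ha, hσ₂ b hb] at hab
  obtain ⟨a, ha⟩ := hPne
  have haP : n (n a) ∈ P := (hn a).2.symm ▸ ha
  obtain ⟨N, hN, hN₀, hNσ⟩ := exists_isMate_of_injective hPM hσinj hadj (n a)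
  -- The `g`-edges avoid `S`, so any edge of `N` in `S` is already in `n`. Minimality then makes the
  -- two traces on `S` equal, forcing `N = n`, although `N` uses a `g`-edge outside `n`.
  have hNS : ∀ v, s(v, N v) ∈ S → N v = n v := by
    intro v hv
    rcases hNσ v with h | h
    · by_cases hP : n v ∈ P
      · rw [h, hσ₁ v hP] at hv
        exact absurd hv (hg v (hvW v hP)).2.2.1
      · rw [h, hσ₂ v hP]
    · by_cases hP : n (N v) ∈ P
      · rw [hσ₁ _ hP] at h
        have h' := (hg _ (hvW _ hP)).2.2.1
        rw [h, Sym2.eq_swap] at h'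
        exact absurd hv h'
      · rw [hσ₂ _ hP] at h
        rw [← h, (hn _).2, h]
  have hNm : ∀ v ∉ W, N v = m v := by
    intro v hv
    rw [← hnm v hv]
    rcases hNσ v with h | h
    · rw [h, hσ₂ v fun hP => hv (hvW v hP)]
    · by_cases hP : n (N v) ∈ P
      · rw [hσ₁ _ hP] at h
        exact absurd (h ▸ (hg _ (hvW _ hP)).1) hv
      · rw [hσ₂ _ hP] at h
        rw [← h, (hn _).2, h]
  have hsubS : (Finset.univ.filter fun v => s(v, N v) ∈ S) ⊆
      Finset.univ.filter fun v => s(v, n v) ∈ S := fun v hv => by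
    simp only [Finset.mem_filter, Finset.mem_univ, true_and] at hv ⊢
    exact hNS v hv ▸ hv
  have heqS := Finset.eq_of_subset_of_card_le hsubS (hmin N ⟨hN, hNm⟩)
  have hNn : N = n := by
    refine hS.eq_of_isMate hN hn fun v hv => hNS v ?_
    rcases hv with h | h
    · exact h
    · have : v ∈ Finset.univ.filter fun v => s(v, n v) ∈ S := by simpa using h
      rw [← heqS] at this
      simpa using this
  rw [hσ₁ _ haP, hNn] at hN₀
  exact (hg _ (hvW _ haP)).2.2.2 hN₀.symm

/-- Induction on `W`, peeling off `u` and `m u` with `u` from `exists_vertex`. Forbidding all other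
edges from `u` into `W` forces `n u = m u`; their number is charged to the edges of `S` at `u`,
which disappear from the smaller set. -/
theorem IsGlobalForcingSet.exists_isolating_edges [Fintype V] [DecidableEq V]
    {G : SimpleGraph V}
    (hPM : perfectMatchingPolytope G =
      {x : G.edgeSet → ℝ | (∀ e, 0 ≤ x e) ∧ IsOneRegular G x})
    {S : Finset (Sym2 V)} (hS : IsGlobalForcingSet G (S : Set (Sym2 V))) {m : V → V}
    (hm : IsMate G m) (W : Finset V) (hmW : ∀ v ∈ W, m v ∈ W) :
    ∃ A : Finset (Sym2 V), (A : Set (Sym2 V)) ⊆ G.edgeSet ∧ (∀ v, s(v, m v) ∉ A) ∧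
      A.card ≤ (S.filter fun e => ∀ v ∈ e, v ∈ W).card ∧
      ∀ n, IsMate G n → (∀ v ∉ W, n v = m v) → (∀ v, s(v, n v) ∉ A) → n = m := by
  classical
  induction W using Finset.strongInduction with
  | H W ih =>
    rcases W.eq_empty_or_nonempty with rfl | hW
    · exact ⟨∅, by simp, by simp, by simp, fun n _ h _ => funext fun v => h v (by simp)⟩
    obtain ⟨u, hu, huniq⟩ := hS.exists_vertex hPM hm hW hmW
    set W' := (W.erase u).erase (m u) with hW'
    have memW' : ∀ v, v ∈ W' ↔ v ≠ m u ∧ v ≠ u ∧ v ∈ W := by simp [hW']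
    have hWW' : W' ⊂ W := Finset.ssubset_iff_of_subset (fun v hv => ((memW' v).1 hv).2.2) |>.2
      ⟨u, hu, fun h => ((memW' u).1 h).2.1 rfl⟩
    have hmW' : ∀ v ∈ W', m v ∈ W' := by
      intro v hv
      obtain ⟨h1, h2, h3⟩ := (memW' v).1 hv
      refine (memW' _).2 ⟨fun h => h2 ?_, fun h => h1 ?_, hmW v h3⟩
      · rw [← (hm v).2, h, (hm u).2]
      · rw [← h, (hm v).2]
    obtain ⟨A, hAE, hAm, hAcard, hA⟩ := ih W' hWW' hmW'
    set N := W.filter fun w => G.Adj u w with hN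
    have hmuN : m u ∈ N := by simp [hN, hmW u hu, (hm u).1]
    have hinj : Function.Injective fun w : V => s(u, w) := fun _ _ h => Sym2.congr_right.1 h
    refine ⟨A ∪ (N.erase (m u)).image fun w => s(u, w), ?_, ?_, ?_, ?_⟩
    · rw [Finset.coe_union, Set.union_subset_iff]
      refine ⟨hAE, ?_⟩
      intro e he
      simp only [Finset.coe_image, Set.mem_image, Finset.mem_coe, Finset.mem_erase, hN,
        Finset.mem_filter] at he
      obtain ⟨w, hw, rfl⟩ := he
      exact hw.2.2
    · intro v hv
      rcases Finset.mem_union.1 hv with hv | hv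
      · exact hAm v hv
      · obtain ⟨w, hw, he⟩ := Finset.mem_image.1 hv
        rw [Finset.mem_erase] at hw
        rcases Sym2.eq_iff.1 he with ⟨h1, h2⟩ | ⟨h1, h2⟩
        · exact hw.1 (h2.trans (h1 ▸ rfl))
        · exact hw.1 (by rw [h1, (hm v).2, h2])
    · have hle1 : (N.filter fun w => s(u, w) ∉ S).card ≤ 1 := by
        refine Finset.card_le_one.2 fun a ha b hb => ?_
        simp only [hN, Finset.mem_filter] at ha hb
        exact huniq a ha.1.1 b hb.1.1 ha.1.2 (by simpa using ha.2) hb.1.2 (by simpa using hb.2)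
      have hsplit := Finset.card_filter_add_card_filter_not (s := N) (fun w => s(u, w) ∈ S)
      -- Sparing `m u` offsets the at most one edge outside `S`, even if it is a different edge.
      have hNle : (N.erase (m u)).card ≤ (N.filter fun w => s(u, w) ∈ S).card := by
        rw [Finset.card_erase_of_mem hmuN]
        omega
      have hdisj : Disjoint (S.filter fun e => ∀ v ∈ e, v ∈ W')
          ((N.filter fun w => s(u, w) ∈ S).image fun w => s(u, w)) := by
        rw [Finset.disjoint_left]
        intro e he he'
        obtain ⟨w, -, rfl⟩ := Finset.mem_image.1 he'
        exact ((memW' u).1 ((Finset.mem_filter.1 he).2 u (Sym2.mem_mk_left u w))).2.1 rfl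
      calc _ ≤ A.card + ((N.erase (m u)).image fun w => s(u, w)).card := Finset.card_union_le _ _
        _ ≤ (S.filter fun e => ∀ v ∈ e, v ∈ W').card +
            ((N.filter fun w => s(u, w) ∈ S).image fun w => s(u, w)).card := by
          rw [Finset.card_image_of_injective _ hinj, Finset.card_image_of_injective _ hinj]
          exact add_le_add hAcard hNle
        _ = _ := (Finset.card_union_of_disjoint hdisj).symm
        _ ≤ _ := by
          refine Finset.card_le_card (Finset.union_subset ?_ ?_)
          · intro e he
            rw [Finset.mem_filter] at he ⊢
            exact ⟨he.1, fun v hv => ((memW' v).1 (he.2 v hv)).2.2⟩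
          · intro e he
            obtain ⟨w, hw, rfl⟩ := Finset.mem_image.1 he
            simp only [hN, Finset.mem_filter] at hw
            rw [Finset.mem_filter]
            refine ⟨hw.2, fun v hv => ?_⟩
            rcases Sym2.mem_iff.1 hv with rfl | rfl
            exacts [hu, hw.1.1]
    · intro n hn hnm hnA
      have hnuW : n u ∈ W := by
        by_contra h
        have h' := hnm _ h
        rw [(hn u).2] at h'
        refine h ?_
        rw [← (hm (n u)).2, ← h']
        exact hmW u hu
      have hnu : n u = m u := by
        by_contra h
        refine hnA u (Finset.mem_union_right _ (Finset.mem_image.2 ⟨n u, ?_, rfl⟩))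
        simp [hN, h, hnuW, (hn u).1]
      refine hA n hn (fun v hv => ?_) fun v hv => hnA v (Finset.mem_union_left _ hv)
      rw [memW'] at hv
      by_cases h1 : v = m u
      · rw [h1, (hm u).2, ← hnu, (hn u).2]
      · by_cases h2 : v = u
        · rw [h2, hnu]
        · exact hnm v fun h3 => hv ⟨h1, h2, h3⟩

theorem IsGlobalForcingSet.af_le_ncard [Fintype V] {G : SimpleGraph V}
    (hPM : perfectMatchingPolytope G =
      {x : G.edgeSet → ℝ | (∀ e, 0 ≤ x e) ∧ IsOneRegular G x})
    {S : Set (Sym2 V)} (hS : IsGlobalForcingSet G S) {M : G.Subgraph}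
    (hM : M.IsPerfectMatching) : af G M ≤ S.ncard := by
  classical
  obtain ⟨T, rfl⟩ := S.toFinite.exists_finset_coe
  obtain ⟨m, hm, hmM⟩ := exists_isMate hM
  obtain ⟨A, hAE, hAm, hAcard, hA⟩ :=
    hS.exists_isolating_edges hPM hm Finset.univ fun v _ => Finset.mem_univ _
  have hanti : IsAntiForcingSet G M (A : Set (Sym2 V)) := by
    refine ⟨fun e he => ⟨hAE he, fun heM => ?_⟩, ?_⟩
    · induction e using Sym2.ind with
      | _ v w =>
        obtain rfl := (hmM v w).1 heM
        exact hAm v he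
    · have hm' : IsMate (G.deleteEdges (A : Set (Sym2 V))) m := fun v =>
        ⟨SimpleGraph.deleteEdges_adj.2 ⟨(hm v).1, hAm v⟩, (hm v).2⟩
      refine ⟨hm'.toSubgraph, hm'.isPerfectMatching, fun M' hM' => ?_⟩
      obtain ⟨n, hn, hnM⟩ := exists_isMate hM'
      have hnm : n = m := hA n
        (fun v => ⟨(SimpleGraph.deleteEdges_adj.1 (hn v).1).1, (hn v).2⟩)
        (fun v hv => absurd (Finset.mem_univ v) hv)
        (fun v => (SimpleGraph.deleteEdges_adj.1 (hn v).1).2)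
      exact eq_of_adj_iff hM' hm'.isPerfectMatching (hnm ▸ hnM) fun _ _ => Iff.rfl
  calc af G M ≤ (A : Set (Sym2 V)).ncard := Nat.sInf_le ⟨_, hanti, rfl⟩
    _ = A.card := Set.ncard_coe_finset A
    _ ≤ T.card := hAcard.trans (Finset.card_filter_le _ _)
    _ = _ := (Set.ncard_coe_finset T).symm

theorem isGlobalForcingSet_edgeSet (G : SimpleGraph V) : IsGlobalForcingSet G G.edgeSet := by
  refine ⟨subset_rfl, fun M₁ M₂ h₁ h₂ h => ?_⟩
  rw [Set.inter_eq_left.2 M₁.edgeSet_subset, Set.inter_eq_left.2 M₂.edgeSet_subset] at h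
  refine SimpleGraph.Subgraph.ext ?_ ?_
  · rw [h₁.2.verts_eq_univ, h₂.2.verts_eq_univ]
  · funext v w
    have := Set.ext_iff.1 h s(v, w)
    simpa using this

theorem Af_le_gf_of_polytope_eq [Fintype V] {G : SimpleGraph V}
    (hG : ∃ M : G.Subgraph, M.IsPerfectMatching)
    (hPM : perfectMatchingPolytope G =
      {x : G.edgeSet → ℝ | (∀ e, 0 ≤ x e) ∧ IsOneRegular G x}) : Af G ≤ gf G := by
  -- The full edge set is global forcing, so the infimum is attained and is not the default value 0
  -- of an empty set.
  obtain ⟨S, hS, hcard⟩ : gf G ∈ {k | ∃ S, IsGlobalForcingSet G S ∧ S.ncard = k} :=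
    Nat.sInf_mem ⟨_, _, isGlobalForcingSet_edgeSet G, rfl⟩
  obtain ⟨M₀, hM₀⟩ := hG
  refine csSup_le ⟨_, M₀, hM₀, rfl⟩ ?_
  rintro k ⟨M, hM, rfl⟩
  exact hcard ▸ hS.af_le_ncard hPM hM

end PMPolytope

theorem mainTheorem8 {V : Type*} [Fintype V] (G : SimpleGraph V)
    (hG : ∃ M : G.Subgraph, M.IsPerfectMatching)
    (hPM : PMPolytope.perfectMatchingPolytope G =
      {x : G.edgeSet → ℝ | (∀ e, 0 ≤ x e) ∧ PMPolytope.IsOneRegular G x}) :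
    PMPolytope.InClassG G ∧ PMPolytope.gf G ≥ PMPolytope.Af G := by
  exact ⟨PMPolytope.inClassG_of_polytope_eq hG hPM, PMPolytope.Af_le_gf_of_polytope_eq hG hPM⟩
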